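/- Let $p,m\in\mathbb N$, let $F\colon\mathbb R^p\times\mathbb R^m\to\mathbb R^p$ be locally Lipschitz (jointly in $(x,\theta)$), and let $J_F\colon\mathbb R^p\times\mathbb R^m\rightrightarrows\mathbb R^{p\times(p+m)}$ be a conservative Jacobian for $F$. That is, $J_F$ has closed graph, is locally bounded, has nonempty values, and for every absolutely continuous path $\gamma\colon[0,1]\to\mathbb R^p\times\mathbb R^m$ one has, for almost every $t\in[0,1]$, $$\frac{d}{dt}F(\gamma(t))=M\,\dot\gamma(t)\quad\text{for all }M\in J_F(\gamma(t)).$$ Assume that there is $0\le\rho<1$ such that for all $(x,\theta)$ and all $[A,B]\in J_F(x,\theta)$, with $A\in\mathbb R^{p\times p}$ and $B\in\mathbb R^{p\times m}$, the operator norm of $A$ (with respect to the Euclidean norm) is at most $\rho$. Let $x_0\colon\mathbb R^m\to\mathbb R^p$ be locally Lipschitz and define $x_{k+1}(\theta)=F(x_k(\theta),\theta)$ for $k\in\mathbb N$. Then for every $\theta$ the map $F(\cdot,\theta)$ has a unique fixed point $\bar x(\theta)$. Moreover, for Lebesgue-almost every $\theta\in\mathbb R^m$, all the maps $x_k$, $k\in\mathbb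 N$, and the map $\bar x$ are differentiable at $\theta$, and their classical Jacobians satisfy $$\lim_{k\to\infty}\frac{\partial x_k}{\partial\theta}(\theta)=\frac{\partial\bar x}{\partial\theta}(\theta).$$ -/

import Mathlib

open Set Filter Topology MeasureTheory

/-- `J` is a conservative Jacobian for `f`, matrices being represented by the linear maps that they
define: `J` has a closed graph, nonempty values, is locally bounded, and along every absolutely
continuous path `γ : [0, 1] → E` one has, for almost every `t`, `d/dt f (γ t) = M (γ' t)` for
all `M ∈ J (γ t)`. (Such a path is differentiable at almost every `t ∈ [0, 1]`, so that
`deriv γ t` is its derivative there. The values of `γ` outside `[0, 1]` play no role.) -/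
structure IsConservativeJacobian {E G : Type*} [NormedAddCommGroup E] [NormedSpace ℝ E]
    [NormedAddCommGroup G] [NormedSpace ℝ G] (f : E → G) (J : E → Set (E →L[ℝ] G)) : Prop where
  isClosed_graph : IsClosed {q : E × (E →L[ℝ] G) | q.2 ∈ J q.1}
  locally_bounded : ∀ z : E, ∃ C : ℝ, ∀ᶠ y in 𝓝 z, ∀ M ∈ J y, ‖M‖ ≤ C
  nonempty : ∀ z : E, (J z).Nonempty
  chain_rule : ∀ γ : ℝ → E, AbsolutelyContinuousOnInterval γ 0 1 →
    ∀ᵐ t ∂(volume.restrict (Icc (0 : ℝ) 1)), ∀ M ∈ J (γ t),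
      HasDerivAt (fun s => f (γ s)) (M (deriv γ t)) t

/-- The standing assumption on the iteration mapping `F`: it is locally Lipschitz, jointly in
`(x, θ)`, it has the conservative Jacobian `JF` (in particular it is path differentiable), and the
operator norms of the blocks `A` of all `[A, B] ∈ JF (x, θ)` are bounded by one `ρ < 1`.
The block `A` of `M = [A, B]` is the linear map `u ↦ M (u, 0)`. -/
structure ConservativeContraction {X Θ : Type*} [NormedAddCommGroup X] [NormedSpace ℝ X]
    [NormedAddCommGroup Θ] [NormedSpace ℝ Θ] (F : X × Θ → X)
    (JF : X × Θ → Set (X × Θ →L[ℝ] X)) : Prop where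
  locallyLipschitz : LocallyLipschitz F
  conservative : IsConservativeJacobian F JF
  contraction : ∃ ρ : ℝ, 0 ≤ ρ ∧ ρ < 1 ∧ ∀ (x : X) (θ : Θ), ∀ M ∈ JF (x, θ),
    ‖M.comp (ContinuousLinearMap.inl ℝ X Θ)‖ ≤ ρ

/-- The iterates `x_{k+1}(θ) = F (x_k(θ), θ)` started at `x₀(θ)`, as functions of `θ`. -/
def piggybackIterate {X Θ : Type*} (F : X × Θ → X) (x₀ : Θ → X) : ℕ → Θ → X
  | 0 => x₀
  | k + 1 => fun θ => F (piggybackIterate F x₀ k θ, θ)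

/-! For almost every `θ` the chain rule holds along `θ ↦ (x_k θ, θ)` for all `k` and along `θ ↦
(xbar θ, θ)`, with every element of `JF` (`ae_fderiv_comp_eq`: chain rule on lines, then Fubini). At
such `θ`, with `D_k`, `D'` the derivatives of `x_k`, `xbar` and any `M_k = [A_k, B_k]` in `JF (x_k
θ, θ)`, `D_{k+1} - D' = A_k (D_k - D') + (M_k (D', id) - D')`. The first term contracts by `ρ`. The
second tends to zero although `M_k` need not converge: its cluster points lie in `JF (xbar θ, θ)`,
where every `M` satisfies `M (D', id) = D'` (`tendsto_of_eq_const`). -/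

theorem LocallyLipschitz.absolutelyContinuousOnInterval {G : Type*} [NormedAddCommGroup G]
    {γ : ℝ → G} (hγ : LocallyLipschitz γ) (a b : ℝ) : AbsolutelyContinuousOnInterval γ a b := by
  obtain ⟨K, hK⟩ := (hγ.locallyLipschitzOn (s := uIcc a b)).exists_lipschitzOnWith_of_compact
    isCompact_uIcc
  exact hK.absolutelyContinuousOnInterval

/-- A perturbed contraction recursion with vanishing perturbation tends to zero. -/
theorem tendsto_zero_of_le_mul_add {a r : ℕ → ℝ} {ρ : ℝ} (hρ0 : 0 ≤ ρ) (hρ1 : ρ < 1)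
    (ha : ∀ k, 0 ≤ a k) (hr : Tendsto r atTop (𝓝 0)) (h : ∀ k, a (k + 1) ≤ ρ * a k + r k) :
    Tendsto a atTop (𝓝 0) := by
  rw [Metric.tendsto_atTop]
  intro ε hε
  -- This size makes `ε / 2` stable under the recursion: `ρ * (ε / 2) + ε / 2 * (1 - ρ) = ε / 2`.
  have hpos : 0 < ε / 2 * (1 - ρ) := mul_pos (half_pos hε) (sub_pos.2 hρ1)
  obtain ⟨N, hN⟩ := eventually_atTop.1 (hr.eventually_le_const hpos)
  have hind : ∀ j, a (N + j) ≤ ρ ^ j * a N + ε / 2 := by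
    intro j
    induction j with
    | zero => simpa using (half_pos hε).le
    | succ j ih =>
      have h1 := h (N + j)
      have h2 := hN (N + j) (Nat.le_add_right _ _)
      have h3 := mul_le_mul_of_nonneg_left ih hρ0
      rw [← add_assoc, pow_succ]
      linarith
  have hlim : Tendsto (fun j => ρ ^ j * a N) atTop (𝓝 0) := by
    simpa using (tendsto_pow_atTop_nhds_zero_of_lt_one hρ0 hρ1).mul_const (a N)
  obtain ⟨j₀, hj₀⟩ := eventually_atTop.1 (hlim.eventually_lt_const (half_pos hε))
  refine ⟨N + j₀, fun n hn => ?_⟩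
  obtain ⟨j, rfl⟩ := Nat.exists_eq_add_of_le ((Nat.le_add_right N j₀).trans hn)
  rw [Real.dist_0_eq_abs, abs_of_nonneg (ha _)]
  linarith [hind j, hj₀ j (by omega)]

theorem piggybackIterate_eq_iterate {X Θ : Type*}
    (F : X × Θ → X) (x₀ : Θ → X) (θ : Θ) (k : ℕ) :
    piggybackIterate F x₀ k θ = (fun x => F (x, θ))^[k] (x₀ θ) := by
  induction k with
  | zero => rfl
  | succ k ih => rw [Function.iterate_succ_apply', ← ih]; rfl

/-- The fixed point of a contraction depends in a locally Lipschitz way on the parameter. -/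
theorem LocallyLipschitz.of_contractingWith {X Θ : Type*} [NormedAddCommGroup X]
    [NormedAddCommGroup Θ] {F : X × Θ → X} (hF : LocallyLipschitz F) {K : NNReal}
    (hK : ∀ θ, ContractingWith K fun x => F (x, θ)) {x : Θ → X} (hx : ∀ θ, F (x θ, θ) = x θ) :
    LocallyLipschitz x := by
  have hdist : ∀ θ θ', dist (x θ) (x θ') ≤ dist (F (x θ', θ)) (F (x θ', θ')) / (1 - K) := by
    intro θ θ'
    have h := (hK θ).dist_le_of_fixedPoint (x θ') (hx θ)
    rwa [hx θ', dist_comm (x θ), dist_comm (F _)]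
  -- Continuity comes first: it keeps `x θ'` in the neighbourhood where the local Lipschitz constant
  -- of `F` is valid.
  have hcont : Continuous x := by
    refine continuous_iff_continuousAt.2 fun θ₀ => ?_
    refine tendsto_iff_dist_tendsto_zero.2
      (squeeze_zero (fun _ => dist_nonneg) (fun θ => hdist θ θ₀) ?_)
    have h : Continuous fun θ => dist (F (x θ₀, θ)) (F (x θ₀, θ₀)) / (1 - K) :=
      ((hF.continuous.comp (by fun_prop)).dist continuous_const).div_const _
    simpa using h.tendsto θ₀
  intro θ₀
  obtain ⟨L, t, ht, hL⟩ := hF (x θ₀, θ₀)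
  obtain ⟨U, hU, V, hV, hUV⟩ := mem_nhds_prod_iff.1 ht
  have hpos : 0 < 1 - (K : ℝ) := (hK θ₀).one_sub_K_pos
  refine ⟨L / (1 - K), V ∩ x ⁻¹' U, inter_mem hV (hcont.continuousAt hU), ?_⟩
  refine LipschitzOnWith.of_dist_le_mul fun θ hθ θ' hθ' => ?_
  have h := hL.dist_le_mul (x θ', θ) (hUV ⟨hθ'.2, hθ.1⟩) (x θ', θ') (hUV ⟨hθ'.2, hθ'.1⟩)
  have h' : dist (x θ', θ) (x θ', θ') = dist θ θ' := by simp [Prod.dist_eq]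
  rw [h'] at h
  rw [NNReal.coe_div, NNReal.coe_sub (hK θ₀).1.le, NNReal.coe_one, div_mul_eq_mul_div]
  exact (hdist θ θ').trans (by gcongr)

section Auxiliary

variable {E G Θ X : Type*}
  [NormedAddCommGroup E] [NormedSpace ℝ E] [NormedAddCommGroup G] [NormedSpace ℝ G]
  [NormedAddCommGroup Θ] [NormedSpace ℝ Θ] [NormedAddCommGroup X] [NormedSpace ℝ X]

/-- **Rademacher's theorem** for locally Lipschitz functions. -/
theorem LocallyLipschitz.ae_differentiableAt [FiniteDimensional ℝ E] [FiniteDimensional ℝ G]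
    [MeasurableSpace E] [BorelSpace E] {μ : Measure E} [μ.IsAddHaarMeasure] {f : E → G}
    (hf : LocallyLipschitz f) : ∀ᵐ x ∂μ, DifferentiableAt ℝ f x := by
  have : ProperSpace E := FiniteDimensional.proper ℝ E
  refine measure_null_of_locally_null _ fun x _ => ?_
  obtain ⟨K, t, ht, hK⟩ := hf x
  have hdiff : ∀ᵐ y ∂μ, y ∈ interior t → DifferentiableAt ℝ f y := by
    filter_upwards [(hK.mono interior_subset).ae_differentiableWithinAt_of_mem (μ := μ)]
      with y hy hyt
    exact (hy hyt).differentiableAt (isOpen_interior.mem_nhds hyt)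
  refine ⟨_, inter_mem_nhdsWithin _ (interior_mem_nhds.2 ht),
    measure_mono_null (fun y hy => ?_) hdiff⟩
  exact fun h => hy.1 (h hy.2)

/-- For a relation `J` with closed graph in finite dimension, the triples `(z, u, w)` for which
all `M ∈ J z` satisfy `M u = w` form a Borel set. -/
theorem measurableSet_setOf_forall_mem_apply_eq [FiniteDimensional ℝ E] [FiniteDimensional ℝ G]
    [MeasurableSpace (E × E × G)] [OpensMeasurableSpace (E × E × G)] {J : E → Set (E →L[ℝ] G)}
    (hJ : IsClosed {q : E × (E →L[ℝ] G) | q.2 ∈ J q.1}) :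
    MeasurableSet {q : E × E × G | ∀ M ∈ J q.1, M q.2.1 = q.2.2} := by
  have : ProperSpace ((E × E × G) × (E →L[ℝ] G)) := FiniteDimensional.proper ℝ _
  -- The complement is a countable union of projections of compact sets, hence Borel.
  let C : ℕ → Set ((E × E × G) × (E →L[ℝ] G)) := fun n =>
    Metric.closedBall 0 n ∩ {q | q.2 ∈ J q.1.1 ∧ (1 : ℝ) / (n + 1) ≤ ‖q.2 q.1.2.1 - q.1.2.2‖}
  have hC : ∀ n, IsCompact (C n) := fun n => by
    refine (isCompact_closedBall _ _).inter_right (IsClosed.inter ?_ ?_)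
    · exact hJ.preimage (f := fun q : (E × E × G) × (E →L[ℝ] G) => (q.1.1, q.2))
        ((continuous_fst.comp continuous_fst).prodMk continuous_snd)
    · refine isClosed_le continuous_const (Continuous.norm (Continuous.sub ?_ ?_))
      · exact continuous_snd.clm_apply (continuous_fst.comp (continuous_snd.comp continuous_fst))
      · exact continuous_snd.comp (continuous_snd.comp continuous_fst)
  have hbad : {q : E × E × G | ∀ M ∈ J q.1, M q.2.1 = q.2.2}ᶜ = ⋃ n, Prod.fst '' C n := by
    ext q
    simp only [mem_compl_iff, mem_ofPred_eq, mem_iUnion, mem_image, not_forall]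
    constructor
    · rintro ⟨M, hM, hne⟩
      have hpos : 0 < ‖M q.2.1 - q.2.2‖ := norm_pos_iff.2 (sub_ne_zero.2 hne)
      obtain ⟨n₁, h₁⟩ := exists_nat_one_div_lt hpos
      obtain ⟨n₂, h₂⟩ := exists_nat_ge ‖(q, M)‖
      refine ⟨max n₁ n₂, (q, M), ⟨?_, hM, ?_⟩, rfl⟩
      · rw [mem_closedBall_zero_iff]
        exact h₂.trans (by exact_mod_cast le_max_right _ _)
      · refine le_trans (Nat.one_div_le_one_div (le_max_left n₁ n₂)) h₁.le
    · rintro ⟨n, ⟨q', M⟩, ⟨-, hM, hle⟩, rfl⟩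
      refine ⟨M, hM, fun h => ?_⟩
      rw [h, sub_self, norm_zero] at hle
      exact absurd hle (not_le.2 (by positivity))
  rw [← MeasurableSet.compl_iff, hbad]
  exact MeasurableSet.iUnion fun n => ((hC n).image continuous_fst).isClosed.measurableSet

namespace IsConservativeJacobian

variable {f : E → G} {J : E → Set (E →L[ℝ] G)}

/-- The chain rule along a locally Lipschitz path defined on the whole line. -/
theorem ae_hasDerivAt_comp (hJ : IsConservativeJacobian f J) {γ : ℝ → E}
    (hγ : LocallyLipschitz γ) :
    ∀ᵐ t : ℝ, ∀ M ∈ J (γ t), HasDerivAt (fun s => f (γ s)) (M (deriv γ t)) t := by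
  -- The chain rule is given on `[0, 1]` only; integer translates cover the line.
  have key : ∀ n : ℤ, ∀ᵐ t : ℝ, t - n ∈ Icc (0 : ℝ) 1 →
      ∀ M ∈ J (γ t), HasDerivAt (fun s => f (γ s)) (M (deriv γ t)) t := by
    intro n
    have hlip : LocallyLipschitz fun s : ℝ => γ (s + n) :=
      hγ.comp (LipschitzWith.id.add (LipschitzWith.const (n : ℝ))).locallyLipschitz
    have h := hJ.chain_rule _ (hlip.absolutelyContinuousOnInterval 0 1)
    rw [ae_restrict_iff' measurableSet_Icc] at h
    filter_upwards [(measurePreserving_sub_right volume (n : ℝ)).quasiMeasurePreserving.ae h]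
      with t ht hmem M hM
    have h1 := ht hmem M (by simpa using hM)
    rw [deriv_comp_add_const, sub_add_cancel] at h1
    simpa using HasDerivAt.comp_sub_const t (n : ℝ) h1
  filter_upwards [ae_all_iff.2 key] with t ht
  exact ht ⌊t⌋ ⟨sub_nonneg.2 (Int.floor_le t), by linarith [Int.lt_floor_add_one t]⟩

/-- The chain rule almost everywhere for the composition with a locally Lipschitz map. -/
theorem ae_fderiv_comp_eq [FiniteDimensional ℝ E] [FiniteDimensional ℝ G]
    [FiniteDimensional ℝ Θ] [MeasurableSpace Θ] [BorelSpace Θ] {μ : Measure Θ}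
    [μ.IsAddHaarMeasure] (hJ : IsConservativeJacobian f J) (hf : LocallyLipschitz f)
    {g : Θ → E} (hg : LocallyLipschitz g) :
    ∀ᵐ θ ∂μ, ∀ M ∈ J (g θ), fderiv ℝ (fun θ' => f (g θ')) θ = M.comp (fderiv ℝ g θ) := by
  have hfg : LocallyLipschitz fun θ' => f (g θ') := hf.comp hg
  have : ProperSpace Θ := FiniteDimensional.proper ℝ Θ
  have : ProperSpace E := FiniteDimensional.proper ℝ E
  have : ProperSpace G := FiniteDimensional.proper ℝ G
  borelize E G
  have dir : ∀ v : Θ, ∀ᵐ θ ∂μ, θ ∈ {θ | DifferentiableAt ℝ g θ →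
      DifferentiableAt ℝ (fun θ' => f (g θ')) θ →
      ∀ M ∈ J (g θ), M (fderiv ℝ g θ v) = fderiv ℝ (fun θ' => f (g θ')) θ v} := by
    intro v
    -- Fubini: a measurable set that meets every line parallel to `v` in almost all of its points
    -- has full measure.
    refine ae_mem_of_ae_add_linearMap_mem (LinearMap.toSpanSingleton ℝ Θ v) volume μ ?_ ?_
    · refine (measurableSet_of_differentiableAt ℝ g).imp
        ((measurableSet_of_differentiableAt ℝ _).imp ?_)
      have hmeas : Measurable fun θ =>
          (g θ, fderiv ℝ g θ v, fderiv ℝ (fun θ' => f (g θ')) θ v) :=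
        hg.continuous.measurable.prodMk ((measurable_fderiv_apply_const ℝ g v).prodMk
          (measurable_fderiv_apply_const ℝ _ v))
      exact hmeas (measurableSet_setOf_forall_mem_apply_eq hJ.isClosed_graph)
    · intro θ
      have hline : LocallyLipschitz fun t : ℝ => θ + t • v :=
        ((LipschitzWith.const θ).add
          ((1 : ℝ →L[ℝ] ℝ).smulRight v).lipschitz).locallyLipschitz
      filter_upwards [hJ.ae_hasDerivAt_comp (hg.comp hline)] with t ht hdg hdfg M hM
      rw [LinearMap.toSpanSingleton_apply] at hdg hdfg hM ⊢
      have hd : HasDerivAt (fun t : ℝ => θ + t • v) v t := by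
        simpa using ((hasDerivAt_id t).smul_const v).const_add θ
      have h1 := hdg.hasFDerivAt.comp_hasDerivAt t hd
      have h2 := hdfg.hasFDerivAt.comp_hasDerivAt t hd
      have h3 := ht M hM
      rw [h1.deriv] at h3
      exact h3.unique h2
  let b := Module.finBasis ℝ Θ
  filter_upwards [ae_all_iff.2 fun i => dir (b i), hg.ae_differentiableAt (μ := μ),
    hfg.ae_differentiableAt (μ := μ)] with θ h hdg hdfg M hM
  refine ContinuousLinearMap.coe_injective (b.ext fun i => ?_)
  exact (h i hdg hdfg M hM).symm

/-- Upper semicontinuity of a conservative Jacobian, tested by a continuous function that is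
constant on the limit value. -/
theorem tendsto_of_eq_const [FiniteDimensional ℝ E] [FiniteDimensional ℝ G]
    (hJ : IsConservativeJacobian f J) {W : Type*} [TopologicalSpace W]
    {Φ : (E →L[ℝ] G) → W} (hΦ : Continuous Φ) {c : W} {z : E} (hc : ∀ M ∈ J z, Φ M = c)
    {u : ℕ → E} (hu : Tendsto u atTop (𝓝 z)) {M : ℕ → E →L[ℝ] G} (hM : ∀ k, M k ∈ J (u k)) :
    Tendsto (fun k => Φ (M k)) atTop (𝓝 c) := by
  have : ProperSpace (E →L[ℝ] G) := FiniteDimensional.proper ℝ _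
  obtain ⟨C, hC⟩ := hJ.locally_bounded z
  refine tendsto_of_subseq_tendsto fun ns hns => ?_
  have hbdd : ∃ᶠ n in atTop, M (ns n) ∈ Metric.closedBall (0 : E →L[ℝ] G) C := by
    refine ((hu.comp hns).eventually hC).frequently.mono fun n hn => ?_
    exact mem_closedBall_zero_iff.2 (hn _ (hM _))
  obtain ⟨L, -, φ, hφ, hL⟩ := tendsto_subseq_of_frequently_bounded
    Metric.isBounded_closedBall hbdd
  have hu' := (hu.comp hns).comp hφ.tendsto_atTop
  have hmem : L ∈ J z := hJ.isClosed_graph.mem_of_tendsto (hu'.prodMk_nhds hL)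
    (Eventually.of_forall fun k => hM _)
  refine ⟨φ, ?_⟩
  rw [← hc L hmem]
  exact (hΦ.tendsto L).comp hL

/-- A mean value inequality for conservative Jacobians. -/
theorem norm_sub_le (hJ : IsConservativeJacobian f J) (hf : LocallyLipschitz f) {x v : E} {C : ℝ}
    (hC : ∀ t : ℝ, ∀ M ∈ J (x + t • v), ‖M v‖ ≤ C) : ‖f (x + v) - f x‖ ≤ C := by
  have hline : LocallyLipschitz fun t : ℝ => x + t • v :=
    ((LipschitzWith.const x).add ((1 : ℝ →L[ℝ] ℝ).smulRight v).lipschitz).locallyLipschitz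
  -- A norming functional reduces the estimate to the scalar fundamental theorem of calculus.
  obtain ⟨φ, hφ, hval⟩ := exists_dual_vector'' ℝ (f (x + v) - f x)
  have hlip : LocallyLipschitz fun t : ℝ => φ (f (x + t • v)) :=
    φ.lipschitz.locallyLipschitz.comp (hf.comp hline)
  have hFTC := (hlip.absolutelyContinuousOnInterval 0 1).integral_deriv_eq_sub
  have hbound : ‖∫ t in (0 : ℝ)..1, deriv (fun t : ℝ => φ (f (x + t • v))) t‖
      ≤ C * |(1 : ℝ) - 0| := by
    refine intervalIntegral.norm_integral_le_of_norm_le_const_ae ?_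
    filter_upwards [hJ.ae_hasDerivAt_comp hline] with t ht _
    obtain ⟨M, hM⟩ := hJ.nonempty (x + t • v)
    have hd : HasDerivAt (fun t : ℝ => x + t • v) v t := by
      simpa using ((hasDerivAt_id t).smul_const v).const_add x
    have h1 := ht M hM
    rw [hd.deriv] at h1
    have h2 := φ.hasFDerivAt.comp_hasDerivAt t h1
    have h3 : deriv (fun t : ℝ => φ (f (x + t • v))) t = φ (M v) := h2.deriv
    rw [h3]
    exact ((φ.le_of_opNorm_le hφ _).trans_eq (one_mul _)).trans (hC t M hM)
  rw [hFTC] at hbound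
  simp only [one_smul, zero_smul, add_zero, ← map_sub, hval] at hbound
  simpa using hbound

end IsConservativeJacobian

namespace ConservativeContraction

variable {F : X × Θ → X} {JF : X × Θ → Set (X × Θ →L[ℝ] X)}

/-- The partial maps `F (·, θ)` are contractions with a common factor. -/
theorem exists_contractingWith (hF : ConservativeContraction F JF) :
    ∃ K : NNReal, ∀ θ, ContractingWith K fun x => F (x, θ) := by
  obtain ⟨ρ, hρ0, hρ1, hρ⟩ := hF.contraction
  lift ρ to NNReal using hρ0
  refine ⟨ρ, fun θ => ⟨by exact_mod_cast hρ1, ?_⟩⟩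
  refine LipschitzWith.of_dist_le_mul fun y x => ?_
  -- The increment has no `θ` component, so only the block `A` acts on it.
  have h := hF.conservative.norm_sub_le hF.locallyLipschitz (x := (x, θ)) (v := (y - x, 0))
    (C := ρ * ‖y - x‖) fun t M hM =>
      (M.comp (ContinuousLinearMap.inl ℝ X Θ)).le_of_opNorm_le (hρ _ _ M hM) (y - x)
  rw [dist_eq_norm, dist_eq_norm]
  simpa using h

theorem locallyLipschitz_piggybackIterate (hF : ConservativeContraction F JF) {x₀ : Θ → X}
    (hx₀ : LocallyLipschitz x₀) : ∀ k, LocallyLipschitz (piggybackIterate F x₀ k)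
  | 0 => hx₀
  | k + 1 => hF.locallyLipschitz.comp
      ((hF.locallyLipschitz_piggybackIterate hx₀ k).prodMk LocallyLipschitz.id)

end ConservativeContraction

/-- Convergence of the derivatives of the iterates at a point where all chain rules hold. -/
theorem ConservativeContraction.tendsto_of_chain_rule [FiniteDimensional ℝ X]
    [FiniteDimensional ℝ Θ] {F : X × Θ → X} {JF : X × Θ → Set (X × Θ →L[ℝ] X)}
    (hF : ConservativeContraction F JF) {θ : Θ} {x : ℕ → X} {y : X}
    (hx : Tendsto x atTop (𝓝 y)) {D : ℕ → Θ →L[ℝ] X} {D' : Θ →L[ℝ] X}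
    (hD : ∀ k, ∀ M ∈ JF (x k, θ), D (k + 1) = M.comp ((D k).prod (.id ℝ Θ)))
    (hD' : ∀ M ∈ JF (y, θ), D' = M.comp (D'.prod (.id ℝ Θ))) :
    Tendsto D atTop (𝓝 D') := by
  obtain ⟨ρ, hρ0, hρ1, hρ⟩ := hF.contraction
  choose M hM using fun k => hF.conservative.nonempty (x k, θ)
  have hr : Tendsto (fun k => (M k).comp (D'.prod (.id ℝ Θ))) atTop (𝓝 D') :=
    hF.conservative.tendsto_of_eq_const (Φ := fun N => N.comp (D'.prod (.id ℝ Θ)))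
      (by fun_prop) (fun N hN => (hD' N hN).symm) (hx.prodMk_nhds tendsto_const_nhds) hM
  rw [tendsto_iff_norm_sub_tendsto_zero] at hr ⊢
  refine tendsto_zero_of_le_mul_add hρ0 hρ1 (fun _ => norm_nonneg _) hr fun k => ?_
  have hsplit : D (k + 1) - D' = ((M k).comp (.inl ℝ X Θ)).comp (D k - D')
      + ((M k).comp (D'.prod (.id ℝ Θ)) - D') := by
    rw [hD k (M k) (hM k)]
    ext v
    have : (M k) (D k v, v) = M k (D k v - D' v, 0) + M k (D' v, v) := by
      rw [← map_add]; simp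
    simp only [sub_apply, add_apply,
      ContinuousLinearMap.comp_apply, ContinuousLinearMap.prod_apply,
      ContinuousLinearMap.inl_apply, ContinuousLinearMap.id_apply, this, add_sub_assoc]
  rw [hsplit]
  refine (norm_add_le _ _).trans (add_le_add_left ?_ _)
  exact (ContinuousLinearMap.opNorm_comp_le _ _).trans
    (mul_le_mul_of_nonneg_right (hρ _ _ _ (hM k)) (norm_nonneg _))

end Auxiliary

theorem mainTheorem3 (p m : ℕ)
    (F : EuclideanSpace ℝ (Fin p) × EuclideanSpace ℝ (Fin m) → EuclideanSpace ℝ (Fin p))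
    (JF : EuclideanSpace ℝ (Fin p) × EuclideanSpace ℝ (Fin m) →
      Set (EuclideanSpace ℝ (Fin p) × EuclideanSpace ℝ (Fin m) →L[ℝ] EuclideanSpace ℝ (Fin p)))
    (x₀ : EuclideanSpace ℝ (Fin m) → EuclideanSpace ℝ (Fin p))
    (hF : ConservativeContraction F JF) (hx₀ : LocallyLipschitz x₀) :
    ∃ xbar : EuclideanSpace ℝ (Fin m) → EuclideanSpace ℝ (Fin p),
      (∀ θ x, F (x, θ) = x ↔ x = xbar θ) ∧
      ∀ᵐ θ ∂(volume : Measure (EuclideanSpace ℝ (Fin m))),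
        (∀ k : ℕ, DifferentiableAt ℝ (piggybackIterate F x₀ k) θ) ∧
        DifferentiableAt ℝ xbar θ ∧
        Tendsto (fun k : ℕ => fderiv ℝ (piggybackIterate F x₀ k) θ) atTop
          (𝓝 (fderiv ℝ xbar θ)) := by
  obtain ⟨K, hK⟩ := hF.exists_contractingWith
  let xbar : EuclideanSpace ℝ (Fin m) → EuclideanSpace ℝ (Fin p) := fun θ => (hK θ).fixedPoint
  have hfix : ∀ θ, F (xbar θ, θ) = xbar θ := fun θ => (hK θ).fixedPoint_isFixedPt
  have hxbar : LocallyLipschitz xbar := hF.locallyLipschitz.of_contractingWith hK hfix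
  have hxk := hF.locallyLipschitz_piggybackIterate hx₀
  refine ⟨xbar, fun θ x => ⟨fun h => (hK θ).fixedPoint_unique h, fun h => h ▸ hfix θ⟩, ?_⟩
  filter_upwards [ae_all_iff.2 fun k => (hxk k).ae_differentiableAt (μ := volume),
    hxbar.ae_differentiableAt (μ := volume),
    ae_all_iff.2 fun k => hF.conservative.ae_fderiv_comp_eq (μ := volume) hF.locallyLipschitz
      ((hxk k).prodMk LocallyLipschitz.id),
    hF.conservative.ae_fderiv_comp_eq (μ := volume) hF.locallyLipschitz
      (hxbar.prodMk LocallyLipschitz.id)] with θ hdk hd hchk hch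
  refine ⟨hdk, hd, hF.tendsto_of_chain_rule (θ := θ) (x := fun k => piggybackIterate F x₀ k θ)
    (y := xbar θ) ?_ ?_ ?_⟩
  · simp only [piggybackIterate_eq_iterate]
    exact (hK θ).tendsto_iterate_fixedPoint (x₀ θ)
  · intro k M hM
    rw [← ((hdk k).hasFDerivAt.prodMk (hasFDerivAt_id θ)).fderiv]
    exact hchk k M hM
  · intro M hM
    rw [← (hd.hasFDerivAt.prodMk (hasFDerivAt_id θ)).fderiv]
    have h := hch M hM
    -- By the fixed point equation, the composite being differentiated is `xbar` itself.
    simp only [id_eq, hfix] at h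
    exact h
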